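/- Let $d,m$ be integers with $d,m\ge 1$, $\theta\in(0,\pi/2)$, and $\alpha\in\mathbb{N}^d$ a multi-index. Put $C(\theta)=\dfrac{16(1+\sin\theta)^2m^2}{3\sin^2\theta}$. For a nonempty finite $X\subset\Omega\subset\mathbb{R}^d$ let $h_{X,\Omega}=\sup_{x\in\Omega}\min_{y\in X}\|x-y\|$ be the fill distance and $q_X=\frac12\min_{y\ne y'\in X}\|y-y'\|$ the separation distance. Let $\Omega_h\subset\mathbb{R}^d$ be a finite set of points, $\bm x_i\in\Omega_h$, $\varepsilon>0$, and let $M_i=\{\bm x_{ij}\}_{j=1}^N$ be the set of the midpoints $\bm x_{ij}=(\bm x_i+\bm x_j)/2$, $\bm x_j\in\Omega_h$, $\|\bm x_j-\bm x_i\|<\varepsilon$ (the degenerate edge $\bm x_j=\bm x_i$ may be either omitted or kept). Let $\Omega\subset\mathbb{R}^d$ be a region (for example a neighborhood of $\bm x_i$; $\Omega_h\subset\Omega$ is not required) with $\bm x_i\in\Omega$, let $\Phi$ be a real function on $[0,\infty)$, and assume: * **C.1** $\Omega$ is compact and satisfies the interior cone condition with radius $r>0$ and angle $\theta$: for every $\bm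 x\in\Omega$ there is a unit vector $\bm\xi$ with $\{\bm x+t\bm y: \|\bm y\|=1,\ \bm y\cdot\bm\xi\ge\cos\theta,\ 0\le t\le r\}\subset\Omega$. * **C.2** $M_i$ is a nonempty subset of $\Omega$, it is quasi-uniform with a constant $c$, i.e. $q_{M_i}\le h\le c\,q_{M_i}$, and $h\le r/C(\theta)$, where $h=h_{M_i,\Omega}$. * **C.3** With $\delta=2C(\theta)h$: $\Phi\ge0$, $\Phi(t)=0$ for $t>\delta$, and $\Phi(t)>0$ for $0\le t<\delta/2$. Let $P_m$ be the space of real polynomials on $\mathbb{R}^d$ of total degree at most $m$, $P=P_m^i=\{p\in P_m: p(\bm x_i)=0\}$, $\omega_j=\Phi(\|\bm x_i-\bm x_{ij}\|)$, and $\tau=\delta_{\bm x_i}\circ D^\alpha$. For $a\in\mathbb{R}^N$ consider the properties * **P.1** $D^\alpha p(\bm x_i)=\sum_{j=1}^N a_j\,p(\bm x_{ij})$ for all $p\in P$; * **P.2** $a_j=0$ whenever $\omega_j=0$; and also $a_j=0$ whenever $\|\bm x_i-\bm x_{ij}\|>2C(\theta)h$. Then there are a constant $C_0>0$ that depends only on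 $d,m,\theta,\alpha$, and constants $C_1(c,\varphi)>0$ that depend only on $d,m,\theta,\alpha$, on $c$ and on a function $\varphi:[0,\infty)\to\mathbb{R}$, such that for all data as above the following hold. 1. There exist coefficients $a_j=a_{ij,\alpha}(\bm x_i)$ with P.1, P.2 and the bound (P.3) $\sum_{j=1}^N|a_j|\le C_0\,h^{-|\alpha|}$. 2. The GMLS problem of minimizing $\frac12\sum_{j=1}^N a_j^2/\omega_j$ subject to P.1 (where $a_j^2/\omega_j$ for $\omega_j=0$ means $0$ if $a_j=0$ and $+\infty$ otherwise) has a unique solution $a$, and it satisfies P.2. If $\Phi(t)=\varphi(t/\delta)$ for all $t\ge0$ with $\varphi$ continuous, then it also satisfies $\sum_{j=1}^N|a_j|\le C_1(c,\varphi)\,h^{-|\alpha|}$. 3. For every real function $u$ on $\mathbb{R}^d$, the problem of minimizing $\frac12\sum_{j=1}^N\big(u(\bm x_{ij})-p(\bm x_{ij})\big)^2\omega_j$ over $p\in P$ has a unique solution $p^*$. For every basis $p_1,\dots,p_Q$ of $P$, the algebraic form of this problem, of minimizing $\frac12(\bm\ell-\mathsf P^T\bm c)^TW(\bm\ell-\mathsf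 P^T\bm c)$ over $\bm c\in\mathbb{R}^Q$ with $\bm\ell=(u(\bm x_{ij}))_j$, $\mathsf P=(p_k(\bm x_{ij}))_{k,j}$, $W=\mathrm{diag}(\omega_j)$, has a unique solution $\bm b$; moreover $p^*=\sum_k b_kp_k$, and the GMLS derivative that $\bm b$ defines satisfies $$\widetilde{D^\alpha}u(\bm x_i):=\sum_{k=1}^Q b_k\,D^\alpha p_k(\bm x_i)=\sum_{j=1}^N a_j\,u(\bm x_{ij}),$$ where $a$ is the solution of the GMLS problem in 2. -/

import Mathlib

noncomputable section

namespace GMLS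

/-! ### Geometry: cone condition, fill distance, quasi-uniformity, midpoints -/

/-- The Euclidean space `ℝ^d`. -/
abbrev E (d : ℕ) : Type := EuclideanSpace ℝ (Fin d)

/-- The cone with vertex `x`, axis `ξ` (a unit vector), angle `θ` and radius `r`. -/
def cone {d : ℕ} (x ξ : E d) (θ r : ℝ) : Set (E d) :=
  {z | ∃ (y : E d) (t : ℝ),
    ‖y‖ = 1 ∧ Real.cos θ ≤ inner ℝ y ξ ∧ 0 ≤ t ∧ t ≤ r ∧ z = x + t • y}

/-- Interior cone condition with radius `r` and angle `θ`. -/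
def InteriorCone {d : ℕ} (Ω : Set (E d)) (r θ : ℝ) : Prop :=
  ∀ x ∈ Ω, ∃ ξ : E d, ‖ξ‖ = 1 ∧ cone x ξ θ r ⊆ Ω

/-- Fill distance `h_{X,Ω} = sup_{x ∈ Ω} min_{y ∈ X} ‖x - y‖`
(used only for nonempty finite `X` and compact `Ω`). -/
def fillDistance {d : ℕ} (X Ω : Set (E d)) : ℝ :=
  sSup ((fun x => Metric.infDist x X) '' Ω)

/-- Separation distance `q_X = (1/2) min_{x ≠ y ∈ X} ‖x - y‖`. -/
def separationDistance {d : ℕ} (X : Set (E d)) : ℝ :=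
  Set.infsep X / 2

/-- `X` is quasi-uniform in `Ω` with constant `c`: `q_X ≤ h_{X,Ω} ≤ c q_X`. -/
def QuasiUniform {d : ℕ} (X Ω : Set (E d)) (c : ℝ) : Prop :=
  separationDistance X ≤ fillDistance X Ω ∧ fillDistance X Ω ≤ c * separationDistance X

/-- The constant `C(θ) = 16 (1 + sin θ)² m² / (3 sin² θ)`. -/
def coneConst (m : ℕ) (θ : ℝ) : ℝ :=
  16 * (1 + Real.sin θ) ^ 2 * (m : ℝ) ^ 2 / (3 * Real.sin θ ^ 2)

/-- The `ε`-neighborhood of `x` in the point set `Ωh`. -/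
def neighborhood {d : ℕ} (Ωh : Finset (E d)) (x : E d) (ε : ℝ) : Set (E d) :=
  {y | y ∈ Ωh ∧ ‖y - x‖ < ε}

/-- The midpoints of the nondegenerate edges that join `x` to the points of its
`ε`-neighborhood. -/
def edgeMidpoints {d : ℕ} (Ωh : Finset (E d)) (x : E d) (ε : ℝ) : Set (E d) :=
  {z | ∃ y ∈ neighborhood Ωh x ε, y ≠ x ∧ z = (1 / 2 : ℝ) • (x + y)}

/-- The region `Ω` is compact and satisfies an interior cone condition with radius `r > 0`
and angle `θ ∈ (0, π/2)`. -/
structure RegionCondition {d : ℕ} (Ω : Set (E d)) (r θ : ℝ) : Prop where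
  isCompact : IsCompact Ω
  r_pos : 0 < r
  θ_pos : 0 < θ
  θ_lt : θ < Real.pi / 2
  interiorCone : InteriorCone Ω r θ

/-- `X` is a (nonempty) finite subset of `Ω`, quasi-uniform with constant `c`, whose fill
distance is at most `h₀ = r / C(θ)`. -/
structure PointCondition {d : ℕ} (X : Finset (E d)) (Ω : Set (E d)) (m : ℕ) (r θ c : ℝ) :
    Prop where
  nonempty : X.Nonempty
  subset : (X : Set (E d)) ⊆ Ω
  quasiUniform : QuasiUniform (X : Set (E d)) Ω c
  fill_le : fillDistance (X : Set (E d)) Ω ≤ r / coneConst m θ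

/-- Condition on the (radial profile of the) weight function: it is nonnegative, vanishes
outside the ball of radius `δ` and is positive in the open ball of radius `δ / 2`. -/
structure WeightCondition (Φ : ℝ → ℝ) (δ : ℝ) : Prop where
  nonneg : ∀ t, 0 ≤ t → 0 ≤ Φ t
  support : ∀ t, δ < t → Φ t = 0
  pos : ∀ t, 0 ≤ t → t < δ / 2 → 0 < Φ t

/-! ### Polynomials and derivatives -/

/-- The linear map that sends a polynomial in `d` variables to its function on `ℝ^d`. -/
def polyFun (d : ℕ) : MvPolynomial (Fin d) ℝ →ₗ[ℝ] (E d → ℝ) :=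
  LinearMap.pi fun x => (MvPolynomial.aeval (fun i => x i)).toLinearMap

/-- `P_m`: polynomial functions on `ℝ^d` of total degree at most `m`. -/
def polySpace (d m : ℕ) : Submodule ℝ (E d → ℝ) :=
  (MvPolynomial.restrictTotalDegree (Fin d) ℝ m).map (polyFun d)

/-- The polynomial functions of degree at most `m` that vanish at `x`. -/
def polySpaceVanishing (d m : ℕ) (x : E d) : Submodule ℝ (E d → ℝ) :=
  polySpace d m ⊓ LinearMap.ker (LinearMap.proj x : (E d → ℝ) →ₗ[ℝ] ℝ)

/-- The partial derivative in the `j`-th coordinate direction. -/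
def partialD {d : ℕ} (j : Fin d) (f : E d → ℝ) : E d → ℝ :=
  fun x => lineDeriv ℝ f x (EuclideanSpace.single j 1)

/-- `D^α`, for a multi-index `α`. -/
def multiD {d : ℕ} (α : Fin d → ℕ) (f : E d → ℝ) : E d → ℝ :=
  (List.finRange d).foldr (fun j g => (partialD j)^[α j] g) f

/-- The order `|α|` of a multi-index. -/
def order {d : ℕ} (α : Fin d → ℕ) : ℕ := ∑ j, α j

/-! ### Generalized moving least squares

`V` is a space of functions, `P` the reproduction space, `lam i` are the sampling functionals,
`τ` is the target functional and `w i = ω(τ; lam i)` are the weights. -/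

section Abstract

variable {V ι : Type*} [AddCommGroup V] [Module ℝ V] [Fintype ι]

/-- The approximation `∑ a_i lam_i` of `τ` is exact on `P`. -/
def Reproduces (P : Submodule ℝ V) (lam : ι → V → ℝ) (τ : V → ℝ) (a : ι → ℝ) : Prop :=
  ∀ u ∈ P, τ u = ∑ i, a i * lam i u

/-- The coefficients have local supports relative to the weights. -/
def LocallySupported (w a : ι → ℝ) : Prop :=
  ∀ i, w i = 0 → a i = 0

/-- The objective `(1/2) ∑ a_i² / w_i` for nonnegative weights `w`. It takes values in `[0, ∞]`:
for `w_i = 0`, the quotient is `∞` if `a_i ≠ 0`, and `0` if `a_i = 0`. -/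
def qpObjective (w a : ι → ℝ) : ENNReal :=
  2⁻¹ * ∑ i, ENNReal.ofReal (a i ^ 2) / ENNReal.ofReal (w i)

/-- `a` solves the GMLS quadratic program: it minimizes the objective among all coefficient
vectors that are exact on `P`. -/
def IsQPSolution (P : Submodule ℝ V) (lam : ι → V → ℝ) (τ : V → ℝ) (w a : ι → ℝ) : Prop :=
  Reproduces P lam τ a ∧
    ∀ a' : ι → ℝ, Reproduces P lam τ a' → qpObjective w a ≤ qpObjective w a'

/-- The weighted least-squares functional `(1/2) ∑ (lam_i u - lam_i p)² w_i`. -/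
def lsObjective (lam : ι → V → ℝ) (w : ι → ℝ) (u p : V) : ℝ :=
  (1 / 2) * ∑ i, (lam i u - lam i p) ^ 2 * w i

/-- `p` is a best weighted least-squares fit out of `P` to the samples of `u`. -/
def IsLSFit (P : Submodule ℝ V) (lam : ι → V → ℝ) (w : ι → ℝ) (u p : V) : Prop :=
  p ∈ P ∧ ∀ q ∈ P, lsObjective lam w u p ≤ lsObjective lam w u q

/-- The matrix `P(Λ)` with entries `lam_i (p_k)`; rows are indexed by `k`, columns by `i`. -/
def sampleMatrix {Q : ℕ} (lam : ι → V → ℝ) (p : Fin Q → V) : Matrix (Fin Q) ι ℝ :=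
  Matrix.of fun k i => lam i (p k)

open Classical in
/-- The algebraic functional `(1/2) (ℓ(u) - P(Λ)ᵀ c)ᵀ W (ℓ(u) - P(Λ)ᵀ c)`, `W = diag(w)`. -/
def algObjective {Q : ℕ} (lam : ι → V → ℝ) (w : ι → ℝ) (p : Fin Q → V) (u : V)
    (c : Fin Q → ℝ) : ℝ :=
  let res : ι → ℝ := (fun i => lam i u) - (sampleMatrix lam p).transpose.mulVec c
  (1 / 2) * dotProduct res ((Matrix.diagonal w).mulVec res)

/-- `b` minimizes the algebraic least-squares functional over `ℝ^Q`. -/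
def IsAlgSolution {Q : ℕ} (lam : ι → V → ℝ) (w : ι → ℝ) (p : Fin Q → V) (u : V)
    (b : Fin Q → ℝ) : Prop :=
  ∀ c : Fin Q → ℝ, algObjective lam w p u b ≤ algObjective lam w p u c

end Abstract

/-! ### Specialization to point samples and derivatives at a point -/

/-- Point evaluations at the points of `X`. -/
def pointSamples {d : ℕ} (X : Finset (E d)) : X → (E d → ℝ) → ℝ :=
  fun y u => u y

/-- The weights `Φ(‖x - y‖)`, `y ∈ X`. -/
def pointWeights {d : ℕ} (Φ : ℝ → ℝ) (x : E d) (X : Finset (E d)) : X → ℝ :=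
  fun y => Φ ‖x - (y : E d)‖

/-- The target functional `δ_x ∘ D^α`. -/
def derivTarget {d : ℕ} (x : E d) (α : Fin d → ℕ) : (E d → ℝ) → ℝ :=
  fun u => multiD α u x

/-- The GMLS derivative `∑ b_k D^α p_k (x)` determined by a coefficient vector `b` relative
to the functions `p_k`. -/
def gmlsDerivative {d Q : ℕ} (x : E d) (α : Fin d → ℕ) (p : Fin Q → E d → ℝ)
    (b : Fin Q → ℝ) : ℝ :=
  ∑ k, b k * derivTarget x α (p k)

end GMLS

end

/-!
Let `K` be the cone at `x`. At a point `z` of a ball inscribed in `K` where `|f|` is maximal,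
Markov's inequality at the endpoint of a segment from `z` shows that `|f|` stays above `|f z| / 2`
on the first `3 / (16 m²)` of every segment into the ball. Hence a set `M` whose density `h` is a
small multiple of the radius of the ball is norming: `|f| ≤ 2 |f y|` on the ball for some `y ∈ M`.
By the equivalence of norms on `P_m` and scaling, `h ^ |α| |D^α f x|` is then at most a constant
times `max |f y|` over the points `y ∈ M` of the ball, and Hahn–Banach in `ℓ^∞` turns this into
coefficients supported in `‖x - y‖ ≤ C(θ) h / 2` with `ℓ¹`-norm at most `C₀ h ^ (-|α|)`.

The minimizer of the quadratic program has the form `a i = w i * p₀ (x i)` with `p₀ ∈ P`, so the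
normal equations of the least-squares problem identify it with the least-squares functional. Its
energy is at most that of the coefficients above, where the weights are bounded below; the
Cauchy–Schwarz inequality and the bounded number of separated points in the support of the weight
then bound its `ℓ¹`-norm.
-/

namespace GMLS

section Markov

open Polynomial

lemma abs_eval_one_derivative_le {n : ℕ} {q : ℝ[X]} (hq : q.natDegree ≤ n) {B : ℝ}
    (hB : ∀ y ∈ Set.Icc (-1 : ℝ) 1, |q.eval y| ≤ B) :
    |q.derivative.eval 1| ≤ (n : ℝ) ^ 2 * B := by
  rcases ((abs_nonneg _).trans (hB 1 (by simp))).eq_or_lt with rfl | hB0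
  · have hq0 : q = 0 := eq_zero_of_infinite_isRoot q <|
      (Set.Icc_infinite (by norm_num : (-1 : ℝ) < 1)).mono fun y hy => abs_nonpos_iff.1 (hB y hy)
    simp [hq0]
  have upper : ∀ p : ℝ[X], p.natDegree ≤ n → (∀ y ∈ Set.Icc (-1 : ℝ) 1, |p.eval y| ≤ B) →
      p.derivative.eval 1 ≤ (n : ℝ) ^ 2 * B := by
    intro p hp hpB
    have h := Chebyshev.eval_iterate_derivative_le_of_forall_abs_le_one (P := C B⁻¹ * p) (k := 1)
      le_rfl (degree_le_of_natDegree_le ((natDegree_C_mul_le _ _).trans hp)) fun y hy => by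
        rw [eval_C_mul, abs_mul, abs_inv, abs_of_pos hB0, inv_mul_le_one₀ hB0]
        exact hpB y hy
    rwa [Function.iterate_one, Chebyshev.derivative_T_eval_one,
      derivative_C_mul, eval_C_mul, inv_mul_le_iff₀' hB0, Int.cast_natCast] at h
  refine abs_le'.2 ⟨upper q hq hB, ?_⟩
  simpa using upper (-q) (by simpa using hq) (by simpa using hB)

lemma abs_eval_derivative_left_le {n : ℕ} {q : ℝ[X]} (hq : q.natDegree ≤ n) {a b B : ℝ}
    (hab : a < b) (hB : ∀ y ∈ Set.Icc a b, |q.eval y| ≤ B) :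
    |q.derivative.eval a| ≤ 2 * (n : ℝ) ^ 2 / (b - a) * B := by
  set l : ℝ[X] := C ((a + b) / 2) - C ((b - a) / 2) * X with hl
  have hl_eval (y : ℝ) : l.eval y = (a + b) / 2 - (b - a) / 2 * y := by simp [hl]
  have hl_deriv : l.derivative = C (-((b - a) / 2)) := by simp [hl]
  have hdeg : (q.comp l).natDegree ≤ n :=
    natDegree_comp_le.trans <| (Nat.mul_le_mul hq (by rw [hl]; compute_degree)).trans_eq (mul_one n)
  have h := abs_eval_one_derivative_le hdeg fun y hy => by
    rw [eval_comp, hl_eval]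
    exact hB _ (by constructor <;> nlinarith [hy.1, hy.2])
  rw [derivative_comp, eval_mul, eval_comp, hl_deriv, eval_C, hl_eval,
    show (a + b) / 2 - (b - a) / 2 * 1 = a by ring, abs_mul, abs_neg,
    abs_of_pos (by linarith : 0 < (b - a) / 2)] at h
  rw [div_mul_eq_mul_div, le_div_iff₀ (by linarith)]
  linarith

lemma abs_eval_zero_le_two_mul_of_isMaxOn {n : ℕ} (hn : 0 < n) {q : ℝ[X]} (hq : q.natDegree ≤ n)
    (hmax : ∀ y ∈ Set.Icc (0 : ℝ) 1, |q.eval y| ≤ |q.eval 0|) {s : ℝ} (hs0 : 0 ≤ s)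
    (hs : 16 * (n : ℝ) ^ 2 * s ≤ 3) : |q.eval 0| ≤ 2 * |q.eval s| := by
  have hn1 : (1 : ℝ) ≤ (n : ℝ) ^ 2 := one_le_pow₀ (by exact_mod_cast hn)
  have hs16 : s ≤ 3 / 16 := by nlinarith
  -- Markov's inequality on `[t, 1]`, whose length is at least `13 / 16`
  have hderiv : ∀ t ∈ Set.Icc 0 s, ‖deriv (fun y => q.eval y) t‖
      ≤ 2 * (n : ℝ) ^ 2 / (13 / 16) * |q.eval 0| := by
    rintro t ⟨ht0, hts⟩
    rw [Polynomial.deriv, Real.norm_eq_abs]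
    refine (abs_eval_derivative_left_le hq (by linarith : t < 1)
      fun y hy => hmax y ⟨ht0.trans hy.1, hy.2⟩).trans ?_
    gcongr
    linarith
  have hdiff := (convex_Icc 0 s).norm_image_sub_le_of_norm_deriv_le
    (fun t _ => q.differentiable t) hderiv ⟨le_rfl, hs0⟩ ⟨hs0, le_rfl⟩
  rw [Real.norm_eq_abs, Real.norm_eq_abs, sub_zero, abs_of_nonneg hs0, abs_sub_comm] at hdiff
  have htri := abs_sub_abs_le_abs_sub (q.eval 0) (q.eval s)
  have hhalf : 2 * (n : ℝ) ^ 2 / (13 / 16) * |q.eval 0| * s ≤ |q.eval 0| / 2 := by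
    linarith [mul_le_mul_of_nonneg_right hs (abs_nonneg (q.eval 0)), abs_nonneg (q.eval 0)]
  linarith

end Markov

section PolynomialFunctions

variable {d m : ℕ}

@[simp] lemma polyFun_apply (F : MvPolynomial (Fin d) ℝ) (x : E d) :
    polyFun d F x = MvPolynomial.aeval (fun i => x i) F := rfl

lemma polyFun_injective : Function.Injective (polyFun d) := fun F G h =>
  MvPolynomial.funext fun x => by
    simpa [MvPolynomial.aeval_eq_eval] using congrFun h (WithLp.toLp 2 x)

lemma continuous_polyFun (F : MvPolynomial (Fin d) ℝ) : Continuous (polyFun d F) :=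
  (MvPolynomial.continuous_eval F).comp (by fun_prop : Continuous fun (x : E d) i => x i)

lemma mem_polySpace {f : E d → ℝ} :
    f ∈ polySpace d m ↔ ∃ F : MvPolynomial (Fin d) ℝ, F.totalDegree ≤ m ∧ polyFun d F = f := by
  simp only [polySpace, Submodule.mem_map, MvPolynomial.mem_restrictTotalDegree]

lemma continuous_of_mem_polySpace {f : E d → ℝ} (hf : f ∈ polySpace d m) : Continuous f := by
  obtain ⟨F, -, rfl⟩ := mem_polySpace.1 hf
  exact continuous_polyFun F

lemma exists_polynomial_eval_eq_add_smul {f : E d → ℝ} (hf : f ∈ polySpace d m) (z v : E d) :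
    ∃ q : Polynomial ℝ, q.natDegree ≤ m ∧ ∀ t : ℝ, q.eval t = f (z + t • v) := by
  obtain ⟨F, hF, rfl⟩ := mem_polySpace.1 hf
  refine ⟨MvPolynomial.aeval (fun i => .C (z i) + .C (v i) * .X) F, ?_, fun t => ?_⟩
  · refine (MvPolynomial.aeval_natDegree_le F hF _ (n := 1) fun i => ?_).trans (mul_one m).le
    compute_degree
  · rw [← Polynomial.coe_aeval_eq_eval, MvPolynomial.comp_aeval_apply, polyFun_apply]
    congr 2
    ext i
    simp [mul_comm (v i)]

lemma totalDegree_aeval_le {R σ τ : Type*} [CommSemiring R] (F : MvPolynomial σ R)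
    {g : σ → MvPolynomial τ R} {n : ℕ} (hg : ∀ i, (g i).totalDegree ≤ n) :
    (MvPolynomial.aeval g F).totalDegree ≤ F.totalDegree * n := by
  rw [MvPolynomial.aeval_def, MvPolynomial.eval₂]
  refine (MvPolynomial.totalDegree_finsetSum _ _).trans (Finset.sup_le fun e he => ?_)
  calc (algebraMap R (MvPolynomial τ R) (F.coeff e) * ∏ i ∈ e.support, g i ^ e i).totalDegree
      ≤ (∏ i ∈ e.support, g i ^ e i).totalDegree := by
        refine (MvPolynomial.totalDegree_mul _ _).trans ?_
        rw [MvPolynomial.algebraMap_eq, MvPolynomial.totalDegree_C, zero_add]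
    _ ≤ ∑ i ∈ e.support, (g i ^ e i).totalDegree := MvPolynomial.totalDegree_finsetProd _ _
    _ ≤ ∑ i ∈ e.support, e i * n := Finset.sum_le_sum fun i _ =>
        (MvPolynomial.totalDegree_pow _ _).trans (Nat.mul_le_mul_left _ (hg i))
    _ = (e.sum fun _ k => k) * n := by rw [Finsupp.sum, Finset.sum_mul]
    _ ≤ F.totalDegree * n := Nat.mul_le_mul_right _ (MvPolynomial.le_totalDegree he)

lemma comp_add_smul_mem_polySpace {f : E d → ℝ} (hf : f ∈ polySpace d m) (z : E d) (c : ℝ) :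
    (fun y => f (z + c • y)) ∈ polySpace d m := by
  obtain ⟨F, hF, rfl⟩ := mem_polySpace.1 hf
  refine mem_polySpace.2 ⟨MvPolynomial.aeval (fun i => .C (z i) + .C c * .X i) F, ?_, ?_⟩
  · refine (totalDegree_aeval_le F (n := 1) fun i => ?_).trans (by simpa using hF)
    refine (MvPolynomial.totalDegree_add _ _).trans (max_le (by simp) ?_)
    exact (MvPolynomial.totalDegree_mul _ _).trans (by simp)
  · ext y
    rw [polyFun_apply, MvPolynomial.comp_aeval_apply, polyFun_apply]
    simp

open Topology in
lemma eq_zero_of_eventually_eq_zero {f : E d → ℝ} (hf : f ∈ polySpace d m) {z : E d}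
    (h : ∀ᶠ y in 𝓝 z, f y = 0) : f = 0 := by
  ext y
  obtain ⟨q, -, hq⟩ := exists_polynomial_eval_eq_add_smul hf z (y - z)
  have hline : Filter.Tendsto (fun t : ℝ => z + t • (y - z)) (𝓝 0) (𝓝 z) :=
    Continuous.tendsto' (by fun_prop) _ _ (by simp)
  have hq0 : q = 0 := by
    refine Polynomial.eq_zero_of_infinite_isRoot q (infinite_of_mem_nhds 0 ?_)
    filter_upwards [hline.eventually h] with t ht
    exact (hq t).trans ht
  simpa [hq0] using (hq 1).symm

end PolynomialFunctions

section Derivatives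

variable {d m : ℕ} (α : Fin d → ℕ)

/-- The derivative `D^α` of polynomials in `d` variables, with the order of differentiation of
`multiD`. -/
noncomputable def polyMultiD : MvPolynomial (Fin d) ℝ →ₗ[ℝ] MvPolynomial (Fin d) ℝ :=
  (List.finRange d).foldr (fun j D => (MvPolynomial.pderiv j).toLinearMap ^ α j * D) 1

lemma partialD_polyFun (j : Fin d) (F : MvPolynomial (Fin d) ℝ) :
    partialD j (polyFun d F) = polyFun d (MvPolynomial.pderiv j F) := by
  ext x
  refine HasLineDerivAt.lineDeriv ?_
  unfold HasLineDerivAt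
  induction F using MvPolynomial.induction_on with
  | C a => simpa using hasDerivAt_const (0 : ℝ) a
  | add p q hp hq => simpa [Pi.add_def] using hp.add hq
  | mul_X p i hp =>
    have hX : HasDerivAt (fun t : ℝ => (x + t • EuclideanSpace.single j (1 : ℝ)) i)
        (if i = j then 1 else 0) 0 := by
      simpa [Pi.single_apply] using
        ((hasDerivAt_id (0 : ℝ)).mul_const (if i = j then (1 : ℝ) else 0)).const_add (x i)
    refine ((hp.mul hX).congr_deriv ?_).congr_of_eventuallyEq (.of_forall fun t => by simp)
    obtain rfl | hij := eq_or_ne i j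
    · simp [add_comm, mul_comm]
    · simp [hij, mul_comm]

lemma partialD_iterate_polyFun (j : Fin d) (k : ℕ) (F : MvPolynomial (Fin d) ℝ) :
    (partialD j)^[k] (polyFun d F) = polyFun d (((MvPolynomial.pderiv j).toLinearMap ^ k) F) := by
  rw [Module.End.pow_apply]
  exact (Function.Semiconj.iterate_right
    (f := polyFun d) (ga := MvPolynomial.pderiv j) (fun G => (partialD_polyFun j G).symm) k F).symm

lemma multiD_polyFun (F : MvPolynomial (Fin d) ℝ) :
    multiD α (polyFun d F) = polyFun d (polyMultiD α F) := by
  unfold multiD polyMultiD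
  induction List.finRange d with
  | nil => rfl
  | cons j l ih => simp only [List.foldr_cons, ih, partialD_iterate_polyFun, Module.End.mul_apply]

variable (m) in
/-- The functional `f ↦ D^α f (x)` on `P_m`. -/
noncomputable def polySpaceDeriv (x : E d) : polySpace d m →ₗ[ℝ] ℝ where
  toFun f := derivTarget x α f
  map_add' := by
    rintro ⟨f, hf⟩ ⟨g, hg⟩
    obtain ⟨F, -, rfl⟩ := mem_polySpace.1 hf
    obtain ⟨G, -, rfl⟩ := mem_polySpace.1 hg
    simp only [derivTarget, AddMemClass.mk_add_mk, ← map_add, multiD_polyFun]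
    simp
  map_smul' := by
    rintro c ⟨f, hf⟩
    obtain ⟨F, -, rfl⟩ := mem_polySpace.1 hf
    simp only [derivTarget, SetLike.mk_smul_mk, ← map_smul, multiD_polyFun]
    simp

lemma partialD_comp_add_smul (j : Fin d) (f : E d → ℝ) (a c : ℝ) (z : E d) :
    partialD j (fun y => a * f (z + c • y)) = fun y => a * c * partialD j f (z + c • y) := by
  ext y
  have h := deriv_comp_mul_left c
    (fun t : ℝ => a * f (z + c • y + t • EuclideanSpace.single j (1 : ℝ))) 0
  simp only [mul_zero, deriv_const_mul_field, smul_eq_mul] at h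
  simp only [partialD, lineDeriv, smul_add, smul_smul, ← add_assoc]
  rw [mul_assoc, mul_left_comm, ← h, ← deriv_const_mul_field]

lemma partialD_iterate_comp_add_smul (j : Fin d) (k : ℕ) (f : E d → ℝ) (a c : ℝ) (z : E d) :
    (partialD j)^[k] (fun y => a * f (z + c • y))
      = fun y => a * c ^ k * (partialD j)^[k] f (z + c • y) := by
  induction k with
  | zero => simp
  | succ k ih =>
    simp only [Function.iterate_succ_apply', ih, partialD_comp_add_smul, pow_succ, ← mul_assoc]

lemma multiD_comp_add_smul (f : E d → ℝ) (z : E d) (c : ℝ) :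
    multiD α (fun y => f (z + c • y)) = fun y => c ^ order α * multiD α f (z + c • y) := by
  have horder : order α = ((List.finRange d).map α).sum := by
    rw [order, ← List.sum_ofFn, List.ofFn_eq_map]
  rw [horder]
  unfold multiD
  induction List.finRange d with
  | nil => simp
  | cons j l ih =>
    simp only [List.foldr_cons, ih, partialD_iterate_comp_add_smul, List.map_cons, List.sum_cons,
      pow_add, mul_comm]

lemma exists_norm_le_mul_norm {𝕜 P A B : Type*} [NontriviallyNormedField 𝕜] [CompleteSpace 𝕜]
    [AddCommGroup P] [Module 𝕜 P] [Module.Finite 𝕜 P] [NormedAddCommGroup A] [NormedSpace 𝕜 A]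
    [SeminormedAddCommGroup B] [NormedSpace 𝕜 B] {J : P →ₗ[𝕜] A} (hJ : Function.Injective J)
    (G : P →ₗ[𝕜] B) : ∃ K : ℝ, 0 < K ∧ ∀ f, ‖G f‖ ≤ K * ‖J f‖ := by
  let e := LinearEquiv.ofInjective J hJ
  obtain ⟨K, hK, hG⟩ := (LinearMap.toContinuousLinearMap (G ∘ₗ e.symm.toLinearMap)).bound
  refine ⟨K, hK, fun f => ?_⟩
  simpa [e] using hG (e f)

/-- The restriction of polynomials to a set, as continuous functions. -/
noncomputable def polyRestrict (s : Set (E d)) : MvPolynomial (Fin d) ℝ →ₗ[ℝ] C(s, ℝ) where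
  toFun F := ⟨fun y => polyFun d F y, (continuous_polyFun F).comp continuous_subtype_val⟩
  map_add' F G := by ext; simp
  map_smul' c F := by ext; simp

lemma polyRestrict_injective {s : Set (E d)} (hs : (interior s).Nonempty) :
    Function.Injective (polyRestrict s) := by
  refine (injective_iff_map_eq_zero _).2 fun F hF => polyFun_injective ?_
  obtain ⟨z, hz⟩ := hs
  rw [map_zero]
  refine eq_zero_of_eventually_eq_zero (mem_polySpace.2 ⟨F, le_rfl, rfl⟩) (z := z) ?_
  filter_upwards [mem_interior_iff_mem_nhds.1 hz] with y hy
  exact DFunLike.congr_fun hF ⟨y, hy⟩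

variable (d m) in
lemma exists_abs_multiD_le (R : ℝ) :
    ∃ K : ℝ, 0 < K ∧ ∀ f ∈ polySpace d m, ∀ B : ℝ,
      (∀ y ∈ Metric.closedBall (0 : E d) 1, |f y| ≤ B) →
      ∀ z ∈ Metric.closedBall (0 : E d) R, |multiD α f z| ≤ K * B := by
  have (r : ℝ) : CompactSpace (Metric.closedBall (0 : E d) r) :=
    isCompact_iff_compactSpace.1 (isCompact_closedBall _ _)
  have hJ : Function.Injective (polyRestrict (Metric.closedBall (0 : E d) 1) ∘ₗ
      (MvPolynomial.restrictTotalDegree (Fin d) ℝ m).subtype) :=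
    (polyRestrict_injective ⟨0, Metric.ball_subset_interior_closedBall (by simp)⟩).comp
      Subtype.val_injective
  obtain ⟨K, hK, hKG⟩ := exists_norm_le_mul_norm hJ
    (polyRestrict (Metric.closedBall 0 R) ∘ₗ polyMultiD α ∘ₗ Submodule.subtype _)
  refine ⟨K, hK, fun f hf B hB z hz => ?_⟩
  obtain ⟨F, hF, rfl⟩ := mem_polySpace.1 hf
  have hB0 : 0 ≤ B := (abs_nonneg _).trans (hB 0 (by simp))
  calc |multiD α (polyFun d F) z|
      = ‖polyRestrict (Metric.closedBall 0 R) (polyMultiD α F) ⟨z, hz⟩‖ := by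
        rw [multiD_polyFun]; rfl
    _ ≤ ‖polyRestrict (Metric.closedBall 0 R) (polyMultiD α F)‖ :=
        ContinuousMap.norm_coe_le_norm _ _
    _ ≤ K * ‖polyRestrict (Metric.closedBall 0 1) F‖ :=
        hKG ⟨F, (MvPolynomial.mem_restrictTotalDegree _ _ _).2 hF⟩
    _ ≤ K * B := by
        gcongr
        exact (ContinuousMap.norm_le _ hB0).2 fun y => hB y y.2

variable (d m) in
lemma exists_pow_mul_abs_multiD_le (R : ℝ) :
    ∃ K : ℝ, 0 < K ∧ ∀ f ∈ polySpace d m, ∀ (z₀ : E d) (ρ B : ℝ), 0 < ρ →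
      (∀ y ∈ Metric.closedBall z₀ ρ, |f y| ≤ B) →
      ∀ z ∈ Metric.closedBall z₀ (R * ρ), ρ ^ order α * |multiD α f z| ≤ K * B := by
  obtain ⟨K, hK, hbound⟩ := exists_abs_multiD_le d m α R
  refine ⟨K, hK, fun f hf z₀ ρ B hρ hB z hz => ?_⟩
  have h := hbound _ (comp_add_smul_mem_polySpace hf z₀ ρ) B
    (fun y hy => hB _ (by
      rw [mem_closedBall_zero_iff] at hy
      simpa [norm_smul, abs_of_pos hρ] using mul_le_of_le_one_right hρ.le hy))
    (ρ⁻¹ • (z - z₀)) (by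
      rw [mem_closedBall_iff_norm] at hz
      rwa [mem_closedBall_zero_iff, norm_smul, norm_inv, Real.norm_of_nonneg hρ.le,
        inv_mul_le_iff₀' hρ])
  simpa [multiD_comp_add_smul, smul_inv_smul₀ hρ.ne', abs_mul, abs_of_pos hρ] using h

end Derivatives

section Coefficients

variable {V ι : Type*} [AddCommGroup V] [Module ℝ V] [Fintype ι]

lemma apply_eq_sum_apply_single_mul {R : Type*} [CommSemiring R] [DecidableEq ι]
    (f : (ι → R) →ₗ[R] R) (v : ι → R) : f v = ∑ i, f (Pi.single i 1) * v i := by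
  conv_lhs => rw [← Finset.univ_sum_single v, map_sum]
  refine Finset.sum_congr rfl fun i _ => ?_
  rw [mul_comm, ← smul_eq_mul, ← map_smul, ← Pi.single_smul', smul_eq_mul, mul_one]

open Classical in
lemma sum_abs_apply_single_le_norm (f : (ι → ℝ) →L[ℝ] ℝ) : ∑ i, |f (Pi.single i 1)| ≤ ‖f‖ := by
  set v : ι → ℝ := fun i => SignType.sign (f (Pi.single i 1)) with hv
  have hv_norm : ‖v‖ ≤ 1 := (pi_norm_le_iff_of_nonneg zero_le_one).2 fun i => by
    simp only [hv]
    cases SignType.sign (f (Pi.single i (1 : ℝ))) <;> simp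
  calc ∑ i, |f (Pi.single i 1)| = ∑ i, f (Pi.single i 1) * v i :=
        Finset.sum_congr rfl fun i _ => (self_mul_sign _).symm
    _ = f v := (apply_eq_sum_apply_single_mul f.toLinearMap v).symm
    _ ≤ ‖f‖ * ‖v‖ := (le_abs_self _).trans (f.le_opNorm v)
    _ ≤ ‖f‖ := mul_le_of_le_one_right (norm_nonneg _) hv_norm

lemma exists_sum_abs_le_of_abs_le_norm (L : ι → V →ₗ[ℝ] ℝ) (τ : V →ₗ[ℝ] ℝ) {K : ℝ} (hK : 0 ≤ K)
    (h : ∀ p, |τ p| ≤ K * ‖fun i => L i p‖) :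
    ∃ a : ι → ℝ, (∀ p, τ p = ∑ i, a i * L i p) ∧ ∑ i, |a i| ≤ K := by
  classical
  let T : V →ₗ[ℝ] (ι → ℝ) := LinearMap.pi L
  obtain ⟨g, rfl⟩ : τ ∈ LinearMap.range T.dualMap := by
    rw [LinearMap.range_dualMap_eq_dualAnnihilator_ker, Submodule.mem_dualAnnihilator]
    refine fun p hp => abs_nonpos_iff.1 ((h p).trans_eq ?_)
    rw [show (fun i => L i p) = 0 from hp, norm_zero, mul_zero]
  obtain ⟨f, hfg, hf⟩ := exists_extension_norm_eq (LinearMap.range T) <|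
    (g.domRestrict (LinearMap.range T)).mkContinuous K <| by rintro ⟨_, p, rfl⟩; exact h p
  have hfT (p : V) : f (T p) = g (T p) := hfg ⟨T p, p, rfl⟩
  refine ⟨fun i => f (Pi.single i 1), fun p => ?_, (sum_abs_apply_single_le_norm f).trans <|
    hf.trans_le (LinearMap.mkContinuous_norm_le _ hK _)⟩
  exact (hfT p).symm.trans (apply_eq_sum_apply_single_mul f.toLinearMap (T p))

lemma exists_sum_abs_le_of_norming (L : ι → V →ₗ[ℝ] ℝ) (τ : V →ₗ[ℝ] ℝ) (S : Set ι) {K : ℝ}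
    (hK : 0 ≤ K) (h : ∀ p, ∃ i ∈ S, |τ p| ≤ K * |L i p|) :
    ∃ a : ι → ℝ, (∀ p, τ p = ∑ i, a i * L i p) ∧ (∀ i ∉ S, a i = 0) ∧ ∑ i, |a i| ≤ K := by
  classical
  obtain ⟨a, ha, haK⟩ := exists_sum_abs_le_of_abs_le_norm (S.indicator L) τ hK fun p => by
    obtain ⟨i, hi, hip⟩ := h p
    refine hip.trans (mul_le_mul_of_nonneg_left ?_ hK)
    simpa [hi] using norm_le_pi_norm (fun i => S.indicator L i p) i
  refine ⟨S.indicator a, fun p => (ha p).trans (Finset.sum_congr rfl fun i _ => ?_),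
    fun i hi => Set.indicator_of_notMem hi a, (Finset.sum_le_sum fun i _ => ?_).trans haK⟩
  · by_cases hi : i ∈ S <;> simp [hi]
  · by_cases hi : i ∈ S <;> simp [hi]

end Coefficients

section QuadraticProgram

variable {V ι : Type*} [AddCommGroup V] [Module ℝ V] [Fintype ι] {w a a' : ι → ℝ}

lemma sum_sq_div_nonneg (hw : ∀ i, 0 ≤ w i) (a : ι → ℝ) : 0 ≤ ∑ i, a i ^ 2 / w i :=
  Finset.sum_nonneg fun i _ => div_nonneg (sq_nonneg _) (hw i)

lemma qpObjective_of_locallySupported (hw : ∀ i, 0 ≤ w i) (ha : LocallySupported w a) :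
    qpObjective w a = 2⁻¹ * ENNReal.ofReal (∑ i, a i ^ 2 / w i) := by
  rw [qpObjective, ENNReal.ofReal_sum_of_nonneg fun i _ => div_nonneg (sq_nonneg _) (hw i)]
  congr 1
  refine Finset.sum_congr rfl fun i _ => ?_
  rcases (hw i).eq_or_lt with h | h
  · simp [← h, ha i h.symm]
  · rw [ENNReal.ofReal_div_of_pos h]

lemma qpObjective_eq_top (ha : ¬ LocallySupported w a) : qpObjective w a = ⊤ := by
  simp only [LocallySupported, not_forall] at ha
  obtain ⟨i, hi, hai⟩ := ha
  have hterm : ENNReal.ofReal (a i ^ 2) / ENNReal.ofReal (w i) = ⊤ := by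
    rw [hi, ENNReal.ofReal_zero, ENNReal.div_zero]
    simpa using hai
  rw [qpObjective, ENNReal.sum_eq_top.2 ⟨i, Finset.mem_univ i, hterm⟩]
  exact ENNReal.mul_top (by simp)

lemma qpObjective_le_iff (hw : ∀ i, 0 ≤ w i) (ha : LocallySupported w a) :
    qpObjective w a' ≤ qpObjective w a ↔
      LocallySupported w a' ∧ ∑ i, a' i ^ 2 / w i ≤ ∑ i, a i ^ 2 / w i := by
  by_cases ha' : LocallySupported w a'
  · rw [qpObjective_of_locallySupported hw ha, qpObjective_of_locallySupported hw ha',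
      ENNReal.mul_le_mul_iff_right (by simp) (by simp),
      ENNReal.ofReal_le_ofReal_iff (sum_sq_div_nonneg hw a), and_iff_right ha']
  · simp only [ha', false_and, iff_false, not_le, qpObjective_eq_top ha',
      qpObjective_of_locallySupported hw ha]
    exact ENNReal.mul_lt_top (by simp) ENNReal.ofReal_lt_top

lemma LocallySupported.eq_of_sum_sq_div_nonpos (hw : ∀ i, 0 ≤ w i) (ha' : LocallySupported w a')
    (ha : LocallySupported w a) (h : ∑ i, (a' i - a i) ^ 2 / w i ≤ 0) : a' = a := by
  have hterm := (Finset.sum_eq_zero_iff_of_nonneg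
    fun i _ => div_nonneg (sq_nonneg (a' i - a i)) (hw i)).1
    (h.antisymm (sum_sq_div_nonneg hw fun i => a' i - a i))
  ext i
  by_cases hi : w i = 0
  · rw [ha' i hi, ha i hi]
  · simpa [hi, sub_eq_zero] using hterm i (Finset.mem_univ i)

variable {P : Submodule ℝ V} {L : ι → V →ₗ[ℝ] ℝ} {τ : V → ℝ} {p : V}

-- Since `a' - a` annihilates `P`, it is orthogonal to `a` for the inner product `∑ a_i b_i / w_i`.
lemma sum_sq_div_eq_add (hp : p ∈ P) (hap : ∀ i, a i = w i * L i p)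
    (ha : Reproduces P (fun i => L i) τ a) (ha' : Reproduces P (fun i => L i) τ a')
    (hs : LocallySupported w a') :
    ∑ i, a' i ^ 2 / w i = ∑ i, a i ^ 2 / w i + ∑ i, (a' i - a i) ^ 2 / w i := by
  have horth : ∑ i, (a' i - a i) * L i p = 0 := by
    simp only [sub_mul, Finset.sum_sub_distrib]
    exact sub_eq_zero.2 ((ha' p hp).symm.trans (ha p hp))
  have hterm : ∀ i, a' i ^ 2 / w i
      = a i ^ 2 / w i + (a' i - a i) ^ 2 / w i + 2 * ((a' i - a i) * L i p) := by
    intro i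
    by_cases hi : w i = 0
    · simp [hs i hi, hap i, hi]
    · rw [hap i]
      field_simp
      ring
  simp only [hterm, Finset.sum_add_distrib, ← Finset.mul_sum, horth, mul_zero, add_zero]

lemma isQPSolution_iff_eq (hw : ∀ i, 0 ≤ w i) (hp : p ∈ P) (hap : ∀ i, a i = w i * L i p)
    (ha : Reproduces P (fun i => L i) τ a) : IsQPSolution P (fun i => L i) τ w a' ↔ a' = a := by
  have hsa : LocallySupported w a := fun i hi => by rw [hap, hi, zero_mul]
  constructor
  · rintro ⟨ha', hmin⟩
    obtain ⟨hsa', hle⟩ := (qpObjective_le_iff hw hsa).1 (hmin a ha)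
    rw [sum_sq_div_eq_add hp hap ha ha' hsa'] at hle
    exact hsa'.eq_of_sum_sq_div_nonpos hw hsa (by linarith)
  · rintro rfl
    refine ⟨ha, fun b hb => ?_⟩
    by_cases hsb : LocallySupported w b
    · rw [qpObjective_le_iff hw hsb, sum_sq_div_eq_add hp hap ha hb hsb]
      exact ⟨hsa, le_add_of_nonneg_right (sum_sq_div_nonneg hw fun i => b i - a' i)⟩
    · exact le_top.trans_eq (qpObjective_eq_top hsb).symm

end QuadraticProgram

section LeastSquares

variable {V ι : Type*} [AddCommGroup V] [Module ℝ V]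

/-- The samples with positive weight determine the elements of the reproduction space `P`. -/
def Unisolvent (P : Submodule ℝ V) (L : ι → V →ₗ[ℝ] ℝ) (w : ι → ℝ) : Prop :=
  ∀ p ∈ P, (∀ i, 0 < w i → L i p = 0) → p = 0

variable {P : Submodule ℝ V} {L : ι → V →ₗ[ℝ] ℝ} {w : ι → ℝ}

lemma Unisolvent.finite [Finite ι] (hU : Unisolvent P L w) : Module.Finite ℝ P := by
  refine Module.Finite.of_injective (LinearMap.pi fun i => w i • L i ∘ₗ P.subtype) <|
    (injective_iff_map_eq_zero _).2 fun p hp => Subtype.ext (hU p p.2 fun i hi => ?_)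
  simpa [hi.ne'] using congrFun hp i

variable [Fintype ι]

lemma Unisolvent.eq_zero_of_sum_mul_sq_nonpos (hU : Unisolvent P L w) (hw : ∀ i, 0 ≤ w i) {p : V}
    (hp : p ∈ P) (h : ∑ i, w i * L i p ^ 2 ≤ 0) : p = 0 := by
  have hnonneg : ∀ i ∈ Finset.univ, 0 ≤ w i * L i p ^ 2 := fun i _ =>
    mul_nonneg (hw i) (sq_nonneg _)
  have hterm := (Finset.sum_eq_zero_iff_of_nonneg hnonneg).1
    (h.antisymm (Finset.sum_nonneg hnonneg))
  exact hU p hp fun i hi => by simpa [hi.ne'] using hterm i (Finset.mem_univ i)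

lemma Unisolvent.exists_normalEquations (hU : Unisolvent P L w) (hw : ∀ i, 0 ≤ w i)
    (g : P →ₗ[ℝ] ℝ) : ∃ p ∈ P, ∀ q : P, ∑ i, w i * L i p * L i q = g q := by
  have := hU.finite
  let G : P →ₗ[ℝ] Module.Dual ℝ P :=
    ∑ i, (L i ∘ₗ P.subtype).smulRight (w i • (L i ∘ₗ P.subtype))
  have hG (p q : P) : G p q = ∑ i, w i * L i p * L i q := by
    simp [G, LinearMap.sum_apply, mul_left_comm, mul_assoc]
  have hinj : Function.Injective G := (injective_iff_map_eq_zero _).2 fun p hp => by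
    refine Subtype.ext (hU.eq_zero_of_sum_mul_sq_nonpos hw p.2 (le_of_eq ?_))
    simpa [hG, sq, mul_assoc] using LinearMap.congr_fun hp p
  obtain ⟨p, hp⟩ := (LinearMap.injective_iff_surjective_of_finrank_eq_finrank
    Subspace.dual_finrank_eq.symm).1 hinj g
  exact ⟨p, p.2, fun q => by rw [← hp, hG]⟩

lemma lsObjective_eq_add {u p q : V} (hp : p ∈ P) (hq : q ∈ P)
    (hnormal : ∀ q ∈ P, ∑ i, w i * L i p * L i q = ∑ i, w i * L i u * L i q) :
    lsObjective (fun i => L i) w u q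
      = lsObjective (fun i => L i) w u p + (1 / 2) * ∑ i, w i * L i (q - p) ^ 2 := by
  have horth := hnormal (p - q) (P.sub_mem hp hq)
  have hexpand : ∑ i, (L i u - L i q) ^ 2 * w i = ∑ i, (L i u - L i p) ^ 2 * w i
      + ∑ i, w i * L i (q - p) ^ 2
      + 2 * (∑ i, w i * L i u * L i (p - q) - ∑ i, w i * L i p * L i (p - q)) := by
    rw [← Finset.sum_sub_distrib, Finset.mul_sum, ← Finset.sum_add_distrib,
      ← Finset.sum_add_distrib]
    refine Finset.sum_congr rfl fun i _ => ?_
    rw [map_sub, map_sub]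
    ring
  rw [lsObjective, hexpand, horth, lsObjective]
  ring

lemma Unisolvent.isLSFit_iff_eq (hU : Unisolvent P L w) (hw : ∀ i, 0 ≤ w i) {u p q : V}
    (hp : p ∈ P) (hnormal : ∀ q ∈ P, ∑ i, w i * L i p * L i q = ∑ i, w i * L i u * L i q) :
    IsLSFit P (fun i => L i) w u q ↔ q = p := by
  constructor
  · rintro ⟨hq, hmin⟩
    have hle := hmin p hp
    rw [lsObjective_eq_add hp hq hnormal] at hle
    exact sub_eq_zero.1 (hU.eq_zero_of_sum_mul_sq_nonpos hw (P.sub_mem hq hp) (by linarith))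
  · rintro rfl
    refine ⟨hp, fun r hr => ?_⟩
    rw [lsObjective_eq_add hp hr hnormal, le_add_iff_nonneg_right]
    exact mul_nonneg one_half_pos.le
      (Finset.sum_nonneg fun i _ => mul_nonneg (hw i) (sq_nonneg _))

lemma algObjective_eq_lsObjective {Q : ℕ} (p : Fin Q → V) (u : V) (c : Fin Q → ℝ) :
    algObjective (fun i => L i) w p u c = lsObjective (fun i => L i) w u (∑ k, c k • p k) := by
  classical
  have hmulVec (i : ι) : (sampleMatrix (fun i => L i) p).transpose.mulVec c i
      = L i (∑ k, c k • p k) := by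
    simp [sampleMatrix, Matrix.mulVec, dotProduct, mul_comm]
  simp only [algObjective, lsObjective, dotProduct, Matrix.mulVec_diagonal, Pi.sub_apply, hmulVec]
  exact congrArg _ (Finset.sum_congr rfl fun i _ => by ring)

lemma coe_equivFun_symm {Q : ℕ} (e : Module.Basis (Fin Q) ℝ P) (c : Fin Q → ℝ) :
    (e.equivFun.symm c : V) = ∑ k, c k • (e k : V) := by
  simp [e.equivFun_symm_apply]

lemma isAlgSolution_iff_isLSFit {Q : ℕ} (e : Module.Basis (Fin Q) ℝ P) {u : V} {b : Fin Q → ℝ} :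
    IsAlgSolution (fun i => L i) w (fun k => (e k : V)) u b ↔
      IsLSFit P (fun i => L i) w u (e.equivFun.symm b) := by
  simp only [IsAlgSolution, IsLSFit, algObjective_eq_lsObjective, ← coe_equivFun_symm]
  refine ⟨fun h => ⟨Subtype.property _, fun q hq => ?_⟩, fun h c => h.2 _ (Subtype.property _)⟩
  simpa using h (e.equivFun ⟨q, hq⟩)

/-- The GMLS coefficients `a` are dual to weighted least squares: every `u` has a unique best fit,
the algebraic problem in any basis of `P` computes it, and the value of `τ` on the fit,
`∑ b_k τ(p_k)`, equals `∑ a_i lam_i u`. -/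
def LeastSquaresDuality (P : Submodule ℝ V) (lam : ι → V → ℝ) (τ : V → ℝ) (w a : ι → ℝ) : Prop :=
  ∀ u : V, (∃! p, IsLSFit P lam w u p) ∧
    ∀ (Q : ℕ) (p : Module.Basis (Fin Q) ℝ P), ∃ b : Fin Q → ℝ,
      IsAlgSolution lam w (fun k => (p k : V)) u b ∧
      (∀ b', IsAlgSolution lam w (fun k => (p k : V)) u b' → b' = b) ∧
      IsLSFit P lam w u (∑ k, b k • (p k : V)) ∧
      ∑ k, b k * τ (p k) = ∑ i, a i * lam i u

variable {τ : V → ℝ} {a : ι → ℝ}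

lemma Reproduces.sum_mul_eq (ha : Reproduces P (fun i => L i) τ a) {Q : ℕ} (b : Fin Q → ℝ)
    (p : Fin Q → P) : ∑ k, b k * τ (p k) = ∑ i, a i * L i (∑ k, b k • (p k : V)) := by
  simp only [ha _ (p _).2, map_sum, map_smul, smul_eq_mul, Finset.mul_sum]
  rw [Finset.sum_comm]
  exact Finset.sum_congr rfl fun i _ => Finset.sum_congr rfl fun k _ => mul_left_comm _ _ _

lemma Unisolvent.leastSquaresDuality (hU : Unisolvent P L w) (hw : ∀ i, 0 ≤ w i) {p₀ : V}
    (hp₀ : p₀ ∈ P) (hap : ∀ i, a i = w i * L i p₀) (ha : Reproduces P (fun i => L i) τ a) :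
    LeastSquaresDuality P (fun i => L i) τ w a := by
  intro u
  obtain ⟨p, hp, hgram⟩ :=
    hU.exists_normalEquations hw (∑ i, (w i * L i u) • (L i ∘ₗ P.subtype))
  have hnormal : ∀ q ∈ P, ∑ i, w i * L i p * L i q = ∑ i, w i * L i u * L i q :=
    fun q hq => by simpa using hgram ⟨q, hq⟩
  have hfit {q : V} := hU.isLSFit_iff_eq (q := q) hw hp hnormal
  refine ⟨⟨p, hfit.2 rfl, fun q => hfit.1⟩, fun Q e => ?_⟩
  have hsol {b : Fin Q → ℝ} : IsAlgSolution (fun i => L i) w (fun k => (e k : V)) u b ↔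
      b = e.equivFun ⟨p, hp⟩ := by
    rw [isAlgSolution_iff_isLSFit, hfit, ← e.equivFun.symm_apply_eq, Subtype.ext_iff]
  refine ⟨e.equivFun ⟨p, hp⟩, hsol.2 rfl, fun b => hsol.1, ?_, ?_⟩
  · simpa only [← coe_equivFun_symm, LinearEquiv.symm_apply_apply] using hfit.2 rfl
  · rw [ha.sum_mul_eq, ← coe_equivFun_symm, LinearEquiv.symm_apply_apply]
    simpa only [hap, mul_right_comm] using hnormal p₀ hp₀

theorem Unisolvent.exists_gmls (hU : Unisolvent P L w) (hw : ∀ i, 0 ≤ w i) {a₀ : ι → ℝ}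
    (h₀ : Reproduces P (fun i => L i) τ a₀) :
    ∃ a : ι → ℝ, (∀ a', IsQPSolution P (fun i => L i) τ w a' ↔ a' = a) ∧
      LeastSquaresDuality P (fun i => L i) τ w a := by
  obtain ⟨p₀, hp₀, hgram⟩ := hU.exists_normalEquations hw (∑ i, a₀ i • (L i ∘ₗ P.subtype))
  have ha : Reproduces P (fun i => L i) τ fun i => w i * L i p₀ :=
    fun q hq => (h₀ q hq).trans (by simpa using (hgram ⟨q, hq⟩).symm)
  exact ⟨_, fun a' => isQPSolution_iff_eq hw hp₀ (fun _ => rfl) ha,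
    hU.leastSquaresDuality hw hp₀ (fun _ => rfl) ha⟩

end LeastSquares

section Norming

lemma exists_mem_closedBall_add_smul_sub_eq {F : Type*} [NormedAddCommGroup F] [NormedSpace ℝ F]
    {z z₀ y : F} {ρ c : ℝ} (hc : 0 < c) (hy : dist (z + c • (z₀ - z)) y ≤ c * ρ) :
    ∃ w ∈ Metric.closedBall z₀ ρ, z + c • (w - z) = y := by
  refine ⟨z₀ + c⁻¹ • (y - (z + c • (z₀ - z))), ?_, ?_⟩
  · rw [mem_closedBall_iff_norm, add_sub_cancel_left, norm_smul, norm_inv, Real.norm_eq_abs,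
      abs_of_pos hc, inv_mul_le_iff₀ hc, ← dist_eq_norm']
    exact hy
  · rw [add_sub_right_comm, smul_add, smul_inv_smul₀ hc.ne', ← add_assoc, add_sub_cancel]

variable {d m : ℕ} {f : E d → ℝ} {M : Set (E d)} {h : ℝ}

lemma abs_le_two_mul_of_isMaxOn (hm : 0 < m) (hf : f ∈ polySpace d m) {s : Set (E d)}
    (hs : Convex ℝ s) {z w : E d} (hz : z ∈ s) (hw : w ∈ s) (hmax : ∀ y ∈ s, |f y| ≤ |f z|)
    {c : ℝ} (hc₀ : 0 ≤ c) (hc : 16 * (m : ℝ) ^ 2 * c ≤ 3) :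
    |f z| ≤ 2 * |f (z + c • (w - z))| := by
  obtain ⟨q, hq, hqf⟩ := exists_polynomial_eval_eq_add_smul hf z (w - z)
  have hq₀ : q.eval 0 = f z := by rw [hqf, zero_smul, add_zero]
  rw [← hq₀, ← hqf]
  refine abs_eval_zero_le_two_mul_of_isMaxOn hm hq (fun t ht => ?_) hc₀ hc
  rw [hq₀, hqf]
  exact hmax _ (hs.add_smul_sub_mem hz hw ht)

lemma exists_norming_point (hm : 0 < m) {z₀ : E d} {ρ : ℝ} (hh : 0 < h)
    (hρ : 16 * (m : ℝ) ^ 2 * h ≤ 3 * ρ)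
    (hfill : ∀ z ∈ Metric.closedBall z₀ ρ, ∃ y ∈ M, dist z y ≤ h) (hf : f ∈ polySpace d m) :
    ∃ y ∈ M, y ∈ Metric.closedBall z₀ ρ ∧ ∀ z ∈ Metric.closedBall z₀ ρ, |f z| ≤ 2 * |f y| := by
  have hm₁ : (1 : ℝ) ≤ (m : ℝ) ^ 2 := one_le_pow₀ (by exact_mod_cast hm)
  have hρ₀ : 0 < ρ := by nlinarith
  have hz₀ : z₀ ∈ Metric.closedBall z₀ ρ := Metric.mem_closedBall_self hρ₀.le
  have hball := convex_closedBall z₀ ρ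
  obtain ⟨z, hz, hmax⟩ := (isCompact_closedBall z₀ ρ).exists_isMaxOn ⟨z₀, hz₀⟩
    (continuous_of_mem_polySpace hf).abs.continuousOn
  have hc₀ : 0 < h / ρ := div_pos hh hρ₀
  have hc : 16 * (m : ℝ) ^ 2 * (h / ρ) ≤ 3 := by
    rwa [← mul_div_assoc, div_le_iff₀ hρ₀]
  have hc₁ : h / ρ ∈ Set.Icc (0 : ℝ) 1 := ⟨hc₀.le, by nlinarith⟩
  obtain ⟨y, hyM, hy⟩ := hfill _ (hball.add_smul_sub_mem hz hz₀ hc₁)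
  -- The point moved from `z` towards the centre is `h`-close to `y`, which therefore lies at the
  -- same ratio `h / ρ` on a segment from `z` to a point of the ball.
  obtain ⟨w, hw, rfl⟩ := exists_mem_closedBall_add_smul_sub_eq hc₀
    (hy.trans_eq (div_mul_cancel₀ h hρ₀.ne').symm)
  exact ⟨_, hyM, hball.add_smul_sub_mem hz hw hc₁, fun z' hz' =>
    (hmax hz').trans (abs_le_two_mul_of_isMaxOn hm hf hball hz hw (fun y hy => hmax hy) hc₀.le hc)⟩

end Norming

section Cones

variable {d m : ℕ} {x ξ z : E d} {θ r r' h : ℝ}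

lemma cone_mono (hr : r ≤ r') : cone x ξ θ r ⊆ cone x ξ θ r' := by
  rintro z ⟨y, t, hy, hyξ, ht₀, ht, rfl⟩
  exact ⟨y, t, hy, hyξ, ht₀, ht.trans hr, rfl⟩

lemma norm_sub_le_of_mem_cone (hz : z ∈ cone x ξ θ r) : ‖x - z‖ ≤ r := by
  obtain ⟨y, t, hy, -, ht₀, ht, rfl⟩ := hz
  rwa [sub_add_cancel_left, norm_neg, norm_smul, hy, mul_one, Real.norm_of_nonneg ht₀]

lemma mem_cone_of_norm_mul_cos_le (hz : z ≠ x) (hr : ‖z - x‖ ≤ r)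
    (hcos : ‖z - x‖ * Real.cos θ ≤ inner ℝ (z - x) ξ) : z ∈ cone x ξ θ r := by
  have hzx : 0 < ‖z - x‖ := norm_pos_iff.2 (sub_ne_zero.2 hz)
  refine ⟨‖z - x‖⁻¹ • (z - x), ‖z - x‖, ?_, ?_, hzx.le, hr, ?_⟩
  · rw [norm_smul, norm_inv, norm_norm, inv_mul_cancel₀ hzx.ne']
  · rwa [real_inner_smul_left, le_inv_mul_iff₀ hzx]
  · rw [smul_inv_smul₀ hzx.ne', add_sub_cancel]

lemma add_smul_mem_cone (hξ : ‖ξ‖ = 1) {t : ℝ} (ht₀ : 0 ≤ t) (ht : t ≤ r) :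
    x + t • ξ ∈ cone x ξ θ r :=
  ⟨ξ, t, hξ, by rw [real_inner_self_eq_norm_sq, hξ, one_pow]; exact Real.cos_le_one θ,
    ht₀, ht, rfl⟩

lemma infinite_cone (hξ : ‖ξ‖ = 1) (hr : 0 < r) : (cone x ξ θ r).Infinite := by
  have hξ₀ : ξ ≠ 0 := norm_ne_zero_iff.1 (hξ ▸ one_ne_zero)
  exact Set.infinite_of_injOn_mapsTo (f := fun t : ℝ => x + t • ξ)
    (fun t _ t' _ htt' => smul_left_injective ℝ hξ₀ (add_left_cancel htt'))
    (fun t ht => add_smul_mem_cone hξ ht.1 ht.2) (Set.Icc_infinite hr)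

lemma closedBall_subset_cone (hξ : ‖ξ‖ = 1) (hθ₀ : 0 < θ) (hθ : θ < Real.pi / 2) {s : ℝ}
    (hs : 0 < s) :
    Metric.closedBall (x + s • ξ) (s * Real.sin θ) ⊆ cone x ξ θ (s * (1 + Real.sin θ)) := by
  intro z hz
  have hcos : 0 < Real.cos θ := Real.cos_pos_of_mem_Ioo ⟨by linarith, hθ⟩
  have hsq := Real.sin_sq_add_cos_sq θ
  have hsin₁ : Real.sin θ < 1 := by nlinarith
  have hsξ : ‖s • ξ‖ = s := by rw [norm_smul, hξ, mul_one, Real.norm_of_nonneg hs.le]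
  have hz' : ‖z - x - s • ξ‖ ≤ s * Real.sin θ := by
    rwa [mem_closedBall_iff_norm, ← sub_sub] at hz
  refine mem_cone_of_norm_mul_cos_le ?_ ?_ ?_
  · rintro rfl
    rw [sub_self, zero_sub, norm_neg, hsξ] at hz'
    nlinarith
  · linarith [norm_sub_norm_le (z - x) (s • ξ)]
  · have hexpand := norm_sub_sq_real (z - x) (s • ξ)
    rw [hsξ, inner_smul_right] at hexpand
    have hle : ‖z - x - s • ξ‖ ^ 2 ≤ (s * Real.sin θ) ^ 2 := by gcongr
    have hmul : 2 * s * (‖z - x‖ * Real.cos θ) ≤ 2 * s * inner ℝ (z - x) ξ := by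
      nlinarith [sq_nonneg (‖z - x‖ - s * Real.cos θ)]
    exact le_of_mul_le_mul_left hmul (by positivity)

lemma coneConst_pos (hm : 0 < m) (hsin : 0 < Real.sin θ) : 0 < coneConst m θ := by
  unfold coneConst
  positivity

lemma exists_norming_closedBall_of_cone (hm : 0 < m) (hθ₀ : 0 < θ) (hθ : θ < Real.pi / 2)
    (hξ : ‖ξ‖ = 1) {M : Set (E d)} (hh : 0 < h)
    (hfill : ∀ z ∈ cone x ξ θ (coneConst m θ * h / 2), ∃ y ∈ M, dist z y ≤ h) :
    ∃ (z₀ : E d) (ρ : ℝ), h ≤ ρ ∧ dist x z₀ = 1 / Real.sin θ * ρ ∧ ∀ f ∈ polySpace d m,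
      ∃ y ∈ M, ‖x - y‖ ≤ coneConst m θ * h / 2 ∧
        ∀ z ∈ Metric.closedBall z₀ ρ, |f z| ≤ 2 * |f y| := by
  have hsin : 0 < Real.sin θ := Real.sin_pos_of_pos_of_lt_pi hθ₀ (by linarith)
  have hsin₁ := Real.sin_le_one θ
  have hm₁ : (1 : ℝ) ≤ (m : ℝ) ^ 2 := one_le_pow₀ (by exact_mod_cast hm)
  -- The height at which the inscribed ball touches the cap of the cone of radius `C(θ) h / 2`.
  obtain ⟨s, hs⟩ : ∃ s, s * (1 + Real.sin θ) = coneConst m θ * h / 2 :=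
    ⟨_, div_mul_cancel₀ _ (by positivity)⟩
  have hs₀ : 0 < s := by
    have hC := coneConst_pos hm hsin
    have hR : 0 < s * (1 + Real.sin θ) := by rw [hs]; positivity
    exact pos_of_mul_pos_left hR (by positivity)
  have hρ : 16 * (m : ℝ) ^ 2 * h ≤ 3 * (s * Real.sin θ) := by
    have hs_eq : 3 * (s * Real.sin θ) * Real.sin θ = 8 * (1 + Real.sin θ) * (m : ℝ) ^ 2 * h := by
      have hpos : 0 < 1 + Real.sin θ := by positivity
      rw [eq_div_of_mul_eq hpos.ne' hs, coneConst]
      field_simp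
      ring
    refine le_of_mul_le_mul_right ?_ hsin
    rw [hs_eq]
    nlinarith [show 0 ≤ 8 * (m : ℝ) ^ 2 * h by positivity]
  have hball := hs ▸ closedBall_subset_cone (x := x) hξ hθ₀ hθ hs₀
  refine ⟨x + s • ξ, s * Real.sin θ, by nlinarith, ?_, fun f hf => ?_⟩
  · rw [dist_self_add_right, norm_smul, hξ, mul_one, Real.norm_of_nonneg hs₀.le]
    field_simp
  · obtain ⟨y, hyM, hy, hfy⟩ := exists_norming_point hm hh hρ (fun z hz => hfill z (hball hz)) hf
    exact ⟨y, hyM, norm_sub_le_of_mem_cone (hball hy), hfy⟩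

end Cones

section LocalReproduction

theorem exists_local_reproduction {d m : ℕ} (hm : 0 < m) (θ : ℝ) (α : Fin d → ℕ) :
    ∃ C₀ : ℝ, 0 < C₀ ∧ ∀ (M : Finset (E d)) (x ξ : E d) (h : ℝ),
      0 < θ → θ < Real.pi / 2 → ‖ξ‖ = 1 → 0 < h →
      (∀ z ∈ cone x ξ θ (coneConst m θ * h / 2), ∃ y ∈ M, dist z y ≤ h) →
      (∀ f ∈ polySpace d m, (∀ y ∈ M, ‖x - y‖ ≤ coneConst m θ * h / 2 → f y = 0) → f = 0) ∧
      ∃ a : M → ℝ, Reproduces (polySpace d m) (pointSamples M) (derivTarget x α) a ∧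
        (∀ y : M, coneConst m θ * h / 2 < ‖x - (y : E d)‖ → a y = 0) ∧
        ∑ y, |a y| ≤ C₀ / h ^ order α := by
  obtain ⟨K, hK, hKf⟩ := exists_pow_mul_abs_multiD_le d m α (1 / Real.sin θ)
  refine ⟨K * 2, by positivity, fun M x ξ h hθ₀ hθ hξ hh hfill => ?_⟩
  obtain ⟨z₀, ρ, hρ, hxz₀, hnorming⟩ := exists_norming_closedBall_of_cone hm hθ₀ hθ hξ hh hfill
  have hρ₀ : 0 < ρ := hh.trans_le hρ
  refine ⟨fun f hf hf₀ => ?_, ?_⟩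
  · obtain ⟨y, hyM, hy, hfy⟩ := hnorming f hf
    refine eq_zero_of_eventually_eq_zero hf (Filter.mem_of_superset
      (Metric.closedBall_mem_nhds z₀ hρ₀) fun z hz => abs_nonpos_iff.1 ((hfy z hz).trans_eq ?_))
    rw [hf₀ y hyM hy, abs_zero, mul_zero]
  · have hτ (f : polySpace d m) : ∃ y ∈ {y : M | ‖x - (y : E d)‖ ≤ coneConst m θ * h / 2},
        |polySpaceDeriv m α x f| ≤ K * 2 / h ^ order α *
          |(LinearMap.proj (y : E d) ∘ₗ (polySpace d m).subtype : _ →ₗ[ℝ] ℝ) f| := by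
      obtain ⟨y, hyM, hy, hfy⟩ := hnorming f f.2
      refine ⟨⟨y, hyM⟩, hy, ?_⟩
      rw [div_mul_eq_mul_div, le_div_iff₀' (pow_pos hh _)]
      calc h ^ order α * |multiD α f x| ≤ ρ ^ order α * |multiD α f x| := by gcongr
        _ ≤ K * (2 * |(f : E d → ℝ) y|) := hKf f f.2 z₀ ρ _ hρ₀ hfy x hxz₀.le
        _ = K * 2 * |(f : E d → ℝ) y| := (mul_assoc _ _ _).symm
    obtain ⟨a, ha, ha₀, haK⟩ := exists_sum_abs_le_of_norming _ _ _ (by positivity) hτ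
    exact ⟨a, fun f hf => ha ⟨f, hf⟩, fun y hy => ha₀ y hy.not_ge, haK⟩

end LocalReproduction

section Weights

variable {ι : Type*} [Fintype ι] {w a b : ι → ℝ}

lemma LocallySupported.sq_sum_abs_le (ha : LocallySupported w a) (hw : ∀ i, 0 ≤ w i) :
    (∑ i, |a i|) ^ 2 ≤ (∑ i, a i ^ 2 / w i) * ∑ i, w i := by
  refine Finset.sum_sq_le_sum_mul_sum_of_sq_le_mul _ (fun i _ => div_nonneg (sq_nonneg _) (hw i))
    (fun i _ => hw i) fun i _ => ?_
  by_cases hi : w i = 0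
  · simp [hi, ha i hi]
  · rw [sq_abs, div_mul_cancel₀ _ hi]

lemma sum_sq_div_le {μ : ℝ} (hμ : 0 < μ) (hb : ∀ i, b i ≠ 0 → μ ≤ w i) :
    ∑ i, b i ^ 2 / w i ≤ (∑ i, |b i|) ^ 2 / μ := by
  calc ∑ i, b i ^ 2 / w i ≤ ∑ i, |b i| ^ 2 / μ := Finset.sum_le_sum fun i _ => by
        by_cases hi : b i = 0
        · simp [hi]
        · rw [sq_abs]
          have hμw := hb i hi
          gcongr
    _ = (∑ i, |b i| ^ 2) / μ := (Finset.sum_div _ _ _).symm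
    _ ≤ (∑ i, |b i|) ^ 2 / μ := by
        gcongr
        exact Finset.sum_sq_le_sq_sum_of_nonneg fun i _ => abs_nonneg _

lemma LocallySupported.sum_abs_le_sqrt_mul (ha : LocallySupported w a) (hw : ∀ i, 0 ≤ w i)
    {μ W : ℝ} (hμ : 0 < μ) (hb : ∀ i, b i ≠ 0 → μ ≤ w i) (hW : ∑ i, w i ≤ W)
    (hab : ∑ i, a i ^ 2 / w i ≤ ∑ i, b i ^ 2 / w i) :
    ∑ i, |a i| ≤ √(W / μ) * ∑ i, |b i| := by
  have hb₀ : 0 ≤ ∑ i, |b i| := Finset.sum_nonneg fun i _ => abs_nonneg _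
  calc ∑ i, |a i| ≤ √(W / μ * (∑ i, |b i|) ^ 2) := Real.le_sqrt_of_sq_le <|
        calc (∑ i, |a i|) ^ 2 ≤ (∑ i, a i ^ 2 / w i) * ∑ i, w i := ha.sq_sum_abs_le hw
          _ ≤ (∑ i, |b i|) ^ 2 / μ * W :=
            mul_le_mul (hab.trans (sum_sq_div_le hμ hb)) hW (Finset.sum_nonneg fun i _ => hw i)
              (by positivity)
          _ = W / μ * (∑ i, |b i|) ^ 2 := by ring
    _ = √(W / μ) * ∑ i, |b i| := by rw [Real.sqrt_mul' _ (sq_nonneg _), Real.sqrt_sq hb₀]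

lemma exists_card_le_of_separated (F : Type*) [NormedAddCommGroup F] [NormedSpace ℝ F]
    [ProperSpace F] {σ : ℝ} (hσ : 0 < σ) :
    ∃ N : ℕ, ∀ (M : Finset F) (x : F) (δ : ℝ), 0 < δ → (M : Set F) ⊆ Metric.closedBall x δ →
      (M : Set F).Pairwise (fun y y' => σ * δ ≤ dist y y') → M.card ≤ N := by
  obtain ⟨t, ht, hcover⟩ := Metric.totallyBounded_iff.1
    (isCompact_closedBall (0 : F) 1).totallyBounded (σ / 2) (half_pos hσ)
  refine ⟨ht.toFinset.card, fun M x δ hδ hM hsep => ?_⟩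
  have hnear (y) (hy : y ∈ M) : ∃ z ∈ t, dist (δ⁻¹ • (y - x)) z < σ / 2 := by
    have hyx : δ⁻¹ • (y - x) ∈ Metric.closedBall (0 : F) 1 := by
      rw [mem_closedBall_zero_iff, norm_smul, norm_inv, Real.norm_of_nonneg hδ.le,
        inv_mul_le_one₀ hδ]
      exact mem_closedBall_iff_norm.1 (hM hy)
    simpa using hcover hyx
  choose! g hgt hg using hnear
  refine Finset.card_le_card_of_injOn g (fun y hy => by simpa using hgt y hy)
    fun y hy y' hy' hgy => by_contra fun hne => ?_
  have hlt : dist (δ⁻¹ • (y - x)) (δ⁻¹ • (y' - x)) < σ :=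
    (dist_triangle_right _ _ (g y)).trans_lt
      ((add_lt_add (hg y hy) (hgy ▸ hg y' hy')).trans_eq (add_halves σ))
  rw [dist_smul₀, dist_sub_right, norm_inv, Real.norm_of_nonneg hδ.le,
    inv_mul_lt_iff₀ hδ, mul_comm] at hlt
  exact (hsep hy hy' hne).not_gt hlt

variable {d : ℕ} {σ : ℝ} {φ : ℝ → ℝ}

lemma exists_sum_pointWeights_le (d : ℕ) (hσ : 0 < σ) (hφ : ContinuousOn φ (Set.Icc 0 1)) :
    ∃ W : ℝ, ∀ (M : Finset (E d)) (x : E d) (δ : ℝ) (Φ : ℝ → ℝ), 0 < δ →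
      (M : Set (E d)).Pairwise (fun y y' => σ * δ ≤ dist y y') → (∀ t, δ < t → Φ t = 0) →
      (∀ t, 0 ≤ t → Φ t = φ (t / δ)) → ∑ y, pointWeights Φ x M y ≤ W := by
  classical
  obtain ⟨N, hN⟩ := exists_card_le_of_separated (E d) hσ
  obtain ⟨B, hB⟩ := isCompact_Icc.exists_bound_of_continuousOn hφ
  have hB₀ : 0 ≤ B := (norm_nonneg _).trans (hB 0 (Set.left_mem_Icc.2 zero_le_one))
  refine ⟨N * B, fun M x δ Φ hδ hsep hsupp hΦφ => ?_⟩
  have hnear : ∀ y ∈ M.filter (‖x - ·‖ ≤ δ), Φ ‖x - y‖ ≤ B := fun y hy => by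
    rw [hΦφ _ (norm_nonneg _)]
    exact (le_abs_self _).trans
      (hB _ ⟨by positivity, (div_le_one hδ).2 (Finset.mem_filter.1 hy).2⟩)
  have hcard : (M.filter (‖x - ·‖ ≤ δ)).card ≤ N := hN _ x δ hδ
    (fun y hy => mem_closedBall_iff_norm'.2 (Finset.mem_filter.1 hy).2)
    (hsep.mono (Finset.coe_subset.2 (Finset.filter_subset _ M)))
  calc ∑ y, pointWeights Φ x M y = ∑ y ∈ M, Φ ‖x - y‖ :=
        Finset.sum_coe_sort M fun y => Φ ‖x - y‖
    _ = ∑ y ∈ M.filter (‖x - ·‖ ≤ δ), Φ ‖x - y‖ :=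
        (Finset.sum_filter_of_ne fun y _ hy => not_lt.1 fun hlt => hy (hsupp _ hlt)).symm
    _ ≤ (M.filter (‖x - ·‖ ≤ δ)).card • B := Finset.sum_le_card_nsmul _ _ _ hnear
    _ ≤ N * B := by rw [nsmul_eq_mul]; gcongr

lemma exists_sum_abs_le_mul_of_separated (d : ℕ) (hσ : 0 < σ)
    (hφ : ContinuousOn φ (Set.Icc 0 1)) (hφ₀ : ∀ t ∈ Set.Icc (0 : ℝ) (1 / 4), 0 < φ t) :
    ∃ A : ℝ, ∀ (M : Finset (E d)) (x : E d) (δ : ℝ) (Φ : ℝ → ℝ), 0 < δ →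
      (M : Set (E d)).Pairwise (fun y y' => σ * δ ≤ dist y y') → WeightCondition Φ δ →
      (∀ t, 0 ≤ t → Φ t = φ (t / δ)) →
      ∀ a b : M → ℝ, LocallySupported (pointWeights Φ x M) a →
        (∀ y : M, δ / 4 < ‖x - (y : E d)‖ → b y = 0) →
        ∑ y, a y ^ 2 / pointWeights Φ x M y ≤ ∑ y, b y ^ 2 / pointWeights Φ x M y →
        ∑ y, |a y| ≤ A * ∑ y, |b y| := by
  obtain ⟨W, hW⟩ := exists_sum_pointWeights_le d hσ hφ
  obtain ⟨t₀, ht₀, hmin⟩ := isCompact_Icc.exists_isMinOn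
    (Set.nonempty_Icc.2 (by norm_num : (0 : ℝ) ≤ 1 / 4))
    (hφ.mono (Set.Icc_subset_Icc_right (by norm_num)))
  refine ⟨√(W / φ t₀), fun M x δ Φ hδ hsep hΦ hΦφ a b ha hb hab => ?_⟩
  refine ha.sum_abs_le_sqrt_mul (fun y => hΦ.nonneg _ (norm_nonneg _)) (hφ₀ t₀ ht₀)
    (fun y hy => ?_) (hW M x δ Φ hδ hsep hΦ.support hΦφ) hab
  have hxy : ‖x - (y : E d)‖ ≤ δ / 4 := not_lt.1 (mt (hb y) hy)
  rw [pointWeights, hΦφ _ (norm_nonneg _)]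
  exact hmin ⟨by positivity, (div_le_iff₀ hδ).2 (by linarith)⟩

lemma WeightCondition.profile_pos {Φ : ℝ → ℝ} {δ : ℝ} (hΦ : WeightCondition Φ δ) (hδ : 0 < δ)
    (hΦφ : ∀ t, 0 ≤ t → Φ t = φ (t / δ)) {t : ℝ} (ht₀ : 0 ≤ t) (ht : t < 1 / 2) : 0 < φ t := by
  have hpos := hΦ.pos (t * δ) (by positivity) (by nlinarith)
  rwa [hΦφ _ (by positivity), mul_div_cancel_right₀ _ hδ.ne'] at hpos

lemma WeightCondition.locallySupported {Φ : ℝ → ℝ} {δ R : ℝ} (hΦ : WeightCondition Φ δ)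
    (hR : R < δ / 2) {M : Finset (E d)} {x : E d} {b : M → ℝ}
    (hb : ∀ y : M, R < ‖x - (y : E d)‖ → b y = 0) : LocallySupported (pointWeights Φ x M) b :=
  fun y hy => hb y (hR.trans_le (not_lt.1 fun hlt => (hΦ.pos _ (norm_nonneg _) hlt).ne' hy))

lemma WeightCondition.unisolvent {Φ : ℝ → ℝ} {δ R : ℝ} (hΦ : WeightCondition Φ δ)
    (hR : R < δ / 2) {M : Finset (E d)} {x : E d} {P : Submodule ℝ (E d → ℝ)}
    (hP : ∀ f ∈ P, (∀ y ∈ M, ‖x - y‖ ≤ R → f y = 0) → f = 0) :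
    Unisolvent P (fun y : M => LinearMap.proj (y : E d)) (pointWeights Φ x M) :=
  fun f hf hfw => hP f hf fun y hy hxy => hfw ⟨y, hy⟩ (hΦ.pos _ (norm_nonneg _) (hxy.trans_lt hR))

end Weights

section FillDistance

variable {d : ℕ} {Ω : Set (E d)}

lemma exists_dist_le_fillDistance {X : Finset (E d)} (hX : X.Nonempty)
    (hΩ : Bornology.IsBounded Ω) {z : E d} (hz : z ∈ Ω) :
    ∃ y ∈ X, dist z y ≤ fillDistance (X : Set (E d)) Ω := by
  obtain ⟨y, hy, hzy⟩ := X.finite_toSet.isCompact.exists_infDist_eq_dist hX z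
  have hbdd : BddAbove ((Metric.infDist · (X : Set (E d))) '' Ω) :=
    ((Metric.lipschitz_infDist_pt _).isBounded_image hΩ).bddAbove
  exact ⟨y, hy, hzy ▸ le_csSup hbdd (Set.mem_image_of_mem _ hz)⟩

lemma fillDistance_pos {X : Finset (E d)} (hX : X.Nonempty) (hΩ : Bornology.IsBounded Ω)
    (hinf : Ω.Infinite) : 0 < fillDistance (X : Set (E d)) Ω := by
  by_contra! hle
  refine hinf (X.finite_toSet.subset fun z hz => ?_)
  obtain ⟨y, hy, hzy⟩ := exists_dist_le_fillDistance hX hΩ hz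
  rwa [dist_le_zero.1 (hzy.trans hle)]

lemma const_pos_of_le_mul_separationDistance {X : Set (E d)} {c h : ℝ} (hh : 0 < h)
    (hc : h ≤ c * separationDistance X) : 0 < c :=
  pos_of_mul_pos_left (hh.trans_le hc) (div_nonneg Set.infsep_nonneg zero_le_two)

lemma pairwise_two_mul_inv_mul_le_dist {X : Set (E d)} {c h : ℝ} (hc₀ : 0 < c)
    (hc : h ≤ c * separationDistance X) : X.Pairwise fun y y' => 2 * (c⁻¹ * h) ≤ dist y y' := by
  intro y hy y' hy' hne
  have hsep : c⁻¹ * h ≤ Set.infsep X / 2 := (inv_mul_le_iff₀ hc₀).2 hc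
  linarith [Set.infsep_le_dist_of_mem hy hy' hne]

lemma exists_sum_abs_le_mul_of_le_mul_separationDistance (d : ℕ) (κ : ℝ) :
    ∃ A : ℝ → (ℝ → ℝ) → ℝ, (∀ c φ, 0 < A c φ) ∧
      ∀ (M : Finset (E d)) (x : E d) (h c : ℝ) (Φ φ : ℝ → ℝ), 0 < κ → 0 < h →
        h ≤ c * separationDistance (M : Set (E d)) → WeightCondition Φ (2 * κ * h) →
        ContinuousOn φ (Set.Icc 0 1) → (∀ t, 0 ≤ t → Φ t = φ (t / (2 * κ * h))) →
        ∀ a b : M → ℝ, LocallySupported (pointWeights Φ x M) a →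
          (∀ y : M, κ * h / 2 < ‖x - (y : E d)‖ → b y = 0) →
          ∑ y, a y ^ 2 / pointWeights Φ x M y ≤ ∑ y, b y ^ 2 / pointWeights Φ x M y →
          ∑ y, |a y| ≤ A c φ * ∑ y, |b y| := by
  choose! A hA using fun σ (hσ : 0 < σ) φ => exists_sum_abs_le_mul_of_separated d (φ := φ) hσ
  refine ⟨fun c φ => max (A (c * κ)⁻¹ φ) 1, fun c φ => by positivity,
    fun M x h c Φ φ hκ hh hc hΦ hφ hΦφ a b ha hb hab => ?_⟩
  have hc₀ := const_pos_of_le_mul_separationDistance hh hc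
  have hδ : 0 < 2 * κ * h := by positivity
  have hsep : (M : Set (E d)).Pairwise fun y y' => (c * κ)⁻¹ * (2 * κ * h) ≤ dist y y' := by
    convert pairwise_two_mul_inv_mul_le_dist hc₀ hc using 4
    field_simp
  have hφ₀ : ∀ t ∈ Set.Icc (0 : ℝ) (1 / 4), 0 < φ t := fun t ht =>
    hΦ.profile_pos hδ hΦφ ht.1 (by linarith [ht.2])
  refine (hA _ (by positivity) φ hφ hφ₀ M x _ Φ hδ hsep hΦ hΦφ a b ha
    (fun y hy => hb y (by linarith)) hab).trans ?_
  gcongr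
  exact le_max_left _ _

end FillDistance

end GMLS

open GMLS in
theorem lemma3p2_general (d m : ℕ) (hm : 0 < m) (θ : ℝ) (α : Fin d → ℕ) :
    ∃ (C₀ : ℝ) (C₁ : ℝ → (ℝ → ℝ) → ℝ), 0 < C₀ ∧ (∀ c φ, 0 < C₁ c φ) ∧
    ∀ (P : Submodule ℝ (E d → ℝ)) (x ξ : E d) (M : Finset (E d)) (Ω : Set (E d)) (r : ℝ)
      (Φ : ℝ → ℝ),
      P ≤ polySpace d m → 0 < θ → θ < Real.pi / 2 → 0 < r → ‖ξ‖ = 1 → cone x ξ θ r ⊆ Ω →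
      Bornology.IsBounded Ω → M.Nonempty → fillDistance (M : Set (E d)) Ω ≤ r / coneConst m θ →
      WeightCondition Φ (2 * coneConst m θ * fillDistance (M : Set (E d)) Ω) →
      (∃ a : M → ℝ, Reproduces P (pointSamples M) (derivTarget x α) a ∧
        LocallySupported (pointWeights Φ x M) a ∧
        ∑ y, |a y| ≤ C₀ / fillDistance (M : Set (E d)) Ω ^ order α ∧
        ∀ y : M, 2 * coneConst m θ * fillDistance (M : Set (E d)) Ω < ‖x - (y : E d)‖ →
          a y = 0) ∧
      ∃ a : M → ℝ,
        IsQPSolution P (pointSamples M) (derivTarget x α) (pointWeights Φ x M) a ∧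
        (∀ a', IsQPSolution P (pointSamples M) (derivTarget x α) (pointWeights Φ x M) a' →
          a' = a) ∧
        Reproduces P (pointSamples M) (derivTarget x α) a ∧
        LocallySupported (pointWeights Φ x M) a ∧
        (∀ c, fillDistance (M : Set (E d)) Ω ≤ c * separationDistance (M : Set (E d)) →
          ∀ φ, ContinuousOn φ (Set.Ici 0) →
          (∀ t, 0 ≤ t → Φ t = φ (t / (2 * coneConst m θ * fillDistance (M : Set (E d)) Ω))) →
          ∑ y, |a y| ≤ C₁ c φ / fillDistance (M : Set (E d)) Ω ^ order α) ∧
        (∀ y : M, 2 * coneConst m θ * fillDistance (M : Set (E d)) Ω < ‖x - (y : E d)‖ →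
          a y = 0) ∧
        LeastSquaresDuality P (pointSamples M) (derivTarget x α) (pointWeights Φ x M) a := by
  obtain ⟨C₀, hC₀, hlocal⟩ := exists_local_reproduction hm θ α
  obtain ⟨A, hA₀, hA⟩ :=
    exists_sum_abs_le_mul_of_le_mul_separationDistance d (coneConst m θ)
  refine ⟨C₀, fun c φ => A c φ * C₀, hC₀, fun c φ => mul_pos (hA₀ c φ) hC₀,
    fun P x ξ M Ω r Φ hP hθ₀ hθ hr hξ hcone hΩ hM hfill hΦ => ?_⟩
  have hh := fillDistance_pos hM hΩ ((infinite_cone hξ hr).mono hcone)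
  have hdense (z) (hz : z ∈ Ω) := exists_dist_le_fillDistance hM hΩ hz
  generalize fillDistance (M : Set (E d)) Ω = h at *
  have hκ := coneConst_pos hm (Real.sin_pos_of_pos_of_lt_pi hθ₀ (by linarith))
  have hκh : 0 < coneConst m θ * h := mul_pos hκ hh
  have hr' : coneConst m θ * h / 2 ≤ r := by linarith [(le_div_iff₀' hκ).1 hfill]
  have hR : coneConst m θ * h / 2 < 2 * coneConst m θ * h / 2 := by linarith
  obtain ⟨hU, a₀, ha₀, ha₀R, ha₀C⟩ := hlocal M x ξ h hθ₀ hθ hξ hh fun z hz =>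
    hdense z (hcone (cone_mono hr' hz))
  have ha₀P : Reproduces P (pointSamples M) (derivTarget x α) a₀ := fun f hf => ha₀ f (hP hf)
  have ha₀l := hΦ.locallySupported hR ha₀R
  have hw (y : M) : 0 ≤ pointWeights Φ x M y := hΦ.nonneg _ (norm_nonneg _)
  have hfar {b : M → ℝ} (hb : LocallySupported (pointWeights Φ x M) b) (y : M)
      (hy : 2 * coneConst m θ * h < ‖x - (y : E d)‖) : b y = 0 := hb y (hΦ.support _ hy)
  obtain ⟨a, ha, hdual⟩ := (hΦ.unisolvent hR fun f hf => hU f (hP hf)).exists_gmls hw ha₀P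
  have haQ := (ha a).2 rfl
  obtain ⟨hal, hle⟩ := (qpObjective_le_iff hw ha₀l).1 (haQ.2 a₀ ha₀P)
  refine ⟨⟨a₀, ha₀P, ha₀l, ha₀C, hfar ha₀l⟩, a, haQ, fun a' => (ha a').1, haQ.1, hal,
    fun c hc φ hφ hΦφ => ?_, hfar hal, hdual⟩
  rw [mul_div_assoc]
  exact (hA M x h c Φ φ hκ hh hc hΦ (hφ.mono Set.Icc_subset_Ici_self) hΦφ a a₀ hal ha₀R hle).trans
    (mul_le_mul_of_nonneg_left ha₀C (hA₀ c φ).le)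

theorem lemma3p2 (d m : ℕ) (hm : 0 < m) (θ : ℝ) (α : Fin d → ℕ) :
    -- `C₀` depends only on `d, m, θ, α`; `C₁` also on the quasi-uniformity constant
    -- and on the rescaled weight profile
    ∃ (C₀ : ℝ) (C₁ : ℝ → (ℝ → ℝ) → ℝ), 0 < C₀ ∧ (∀ c φ, 0 < C₁ c φ) ∧
    ∀ (Ωh : Finset (GMLS.E d)) (x : GMLS.E d) (ε : ℝ) (M : Finset (GMLS.E d))
      (Ω : Set (GMLS.E d)) (r c : ℝ) (Φ : ℝ → ℝ),
      x ∈ Ωh → 0 < ε →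
      -- `M` is the set of midpoints, without or with the degenerate edge from `x` to `x`
      ((M : Set (GMLS.E d)) = GMLS.edgeMidpoints Ωh x ε ∨
        (M : Set (GMLS.E d)) = insert x (GMLS.edgeMidpoints Ωh x ε)) →
      x ∈ Ω →
      GMLS.RegionCondition Ω r θ →
      GMLS.PointCondition M Ω m r θ c →
      GMLS.WeightCondition Φ
        (2 * GMLS.coneConst m θ * GMLS.fillDistance (M : Set (GMLS.E d)) Ω) →
      -- coefficients with a bound that does not depend on the weight
      (∃ a : M → ℝ,
        GMLS.Reproduces (GMLS.polySpaceVanishing d m x) (GMLS.pointSamples M)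
          (GMLS.derivTarget x α) a ∧
        GMLS.LocallySupported (GMLS.pointWeights Φ x M) a ∧
        ∑ y, |a y| ≤ C₀ / GMLS.fillDistance (M : Set (GMLS.E d)) Ω ^ GMLS.order α ∧
        ∀ y : M, 2 * GMLS.coneConst m θ * GMLS.fillDistance (M : Set (GMLS.E d)) Ω
          < ‖x - (y : GMLS.E d)‖ → a y = 0) ∧
      -- the GMLS coefficients and the equivalent least-squares problem
      (∃ a : M → ℝ,
        GMLS.IsQPSolution (GMLS.polySpaceVanishing d m x) (GMLS.pointSamples M)
          (GMLS.derivTarget x α) (GMLS.pointWeights Φ x M) a ∧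
        (∀ a' : M → ℝ,
          GMLS.IsQPSolution (GMLS.polySpaceVanishing d m x) (GMLS.pointSamples M)
            (GMLS.derivTarget x α) (GMLS.pointWeights Φ x M) a' → a' = a) ∧
        GMLS.Reproduces (GMLS.polySpaceVanishing d m x) (GMLS.pointSamples M)
          (GMLS.derivTarget x α) a ∧
        GMLS.LocallySupported (GMLS.pointWeights Φ x M) a ∧
        (∀ φ : ℝ → ℝ, ContinuousOn φ (Set.Ici 0) →
          (∀ t, 0 ≤ t → Φ t =
            φ (t / (2 * GMLS.coneConst m θ * GMLS.fillDistance (M : Set (GMLS.E d)) Ω))) →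
          ∑ y, |a y| ≤ C₁ c φ / GMLS.fillDistance (M : Set (GMLS.E d)) Ω ^ GMLS.order α) ∧
        (∀ y : M, 2 * GMLS.coneConst m θ * GMLS.fillDistance (M : Set (GMLS.E d)) Ω
          < ‖x - (y : GMLS.E d)‖ → a y = 0) ∧
        ∀ u : GMLS.E d → ℝ,
          (∃! pstar : GMLS.E d → ℝ,
            GMLS.IsLSFit (GMLS.polySpaceVanishing d m x) (GMLS.pointSamples M)
              (GMLS.pointWeights Φ x M) u pstar) ∧
          ∀ (Q : ℕ) (p : Module.Basis (Fin Q) ℝ (GMLS.polySpaceVanishing d m x)),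
            ∃ b : Fin Q → ℝ,
              GMLS.IsAlgSolution (GMLS.pointSamples M) (GMLS.pointWeights Φ x M)
                (fun k => (p k : GMLS.E d → ℝ)) u b ∧
              (∀ b' : Fin Q → ℝ,
                GMLS.IsAlgSolution (GMLS.pointSamples M) (GMLS.pointWeights Φ x M)
                  (fun k => (p k : GMLS.E d → ℝ)) u b' → b' = b) ∧
              GMLS.IsLSFit (GMLS.polySpaceVanishing d m x) (GMLS.pointSamples M)
                (GMLS.pointWeights Φ x M) u (∑ k, b k • (p k : GMLS.E d → ℝ)) ∧
              GMLS.gmlsDerivative x α (fun k => (p k : GMLS.E d → ℝ)) b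
                = ∑ y : M, a y * u y) := by
  obtain ⟨C₀, C₁, hC₀, hC₁, h⟩ := lemma3p2_general d m hm θ α
  refine ⟨C₀, C₁, hC₀, hC₁, fun _ x _ M Ω r c Φ _ _ _ hx hΩ hM hΦ => ?_⟩
  obtain ⟨ξ, hξ, hcone⟩ := hΩ.interiorCone x hx
  obtain ⟨ha₀, a, haQ, huniq, ha, hal, haC, hdual⟩ := h _ x ξ M Ω r Φ inf_le_left hΩ.θ_pos
    hΩ.θ_lt hΩ.r_pos hξ hcone hΩ.isCompact.isBounded hM.nonempty hM.fill_le hΦ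
  exact ⟨ha₀, a, haQ, huniq, ha, hal, haC c hM.quasiUniform.2, hdual⟩
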